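/- Conventions. Let $d$ and $\rho$ be metrics on the same set $X$. For a homeomorphism $\eta\colon[0,\infty)\to[0,\infty)$, the metric $d$ is $\eta$-quasisymmetric to $\rho$ if $$\rho(p,q)\le \eta\!\left(\frac{d(p,q)}{d(q,s)}\right)\rho(q,s)\qquad\text{for all } p,q,s\in X,\ s\ne q .$$ The metrics $d$ and $\rho$ are locally isometric (through the identity map) if every point of $X$ has a neighbourhood, open for both metrics, on which $d$ and $\rho$ coincide. The Gromov–Hausdorff distance between two metric spaces is the infimum of the Hausdorff distances between $f(X)$ and $g(Y)$ over all metric spaces $Z$ and isometric embeddings $f\colon X\to Z$, $g\colon Y\to Z$. For a smooth Riemannian metric $g$ on a connected manifold, $d_g$ is the induced distance (infimum of the $g$-lengths of paths). Manifolds are smooth, Hausdorff and without boundary. **Theorem.** For every integer $n\ge 0$ and every homeomorphism $\eta\colon[0,\infty)\to[0,\infty)$ there is a homeomorphism $\eta'\colon[0,\infty)\to[0,\infty)$, depending only on $n$ and $\eta$, with the following property. Let $X$ be a compact connected smooth $n$-manifold with a smooth Riemannian metric $g$, and let $d$ be a metric on $X$ that is $\eta$-quasisymmetric to $d_g$. Then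 there are a sequence $(\rho_k)_{k\in\mathbb N}$ of metrics on $X$ and a sequence $(h_k)_{k\in\mathbb N}$ of smooth Riemannian metrics on $X$ such that 1. for every $k$, the metric space $(X,\rho_k)$ is locally isometric to the Riemannian manifold $(X,d_{h_k})$ (through the identity map); 2. for every $k$, the metric $\rho_k$ is $\eta'$-quasisymmetric to $d_g$; 3. $(X,\rho_k)$ converges to $(X,d)$ in the Gromov–Hausdorff distance as $k\to\infty$. -/

import Mathlib

open Set Filter Topology Bundle
open scoped NNReal ENNReal Manifold ContDiff

universe u

section RiemannianDistance

variable {n : ℕ} {X : Type u} [TopologicalSpace X]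
  [ChartedSpace (EuclideanSpace ℝ (Fin n)) X] [IsManifold (𝓡 n) ∞ X]

/-- A smooth Riemannian metric on the smooth `n`-manifold `X` (without boundary, as it is modelled
on `ℝⁿ`): a smooth field of inner products on the tangent spaces. -/
abbrev SmoothRiemannianMetric (n : ℕ) (X : Type u) [TopologicalSpace X]
    [ChartedSpace (EuclideanSpace ℝ (Fin n)) X] [IsManifold (𝓡 n) ∞ X] : Type u :=
  ContMDiffRiemannianMetric (𝓡 n) ∞ (EuclideanSpace ℝ (Fin n))
    (fun x : X => TangentSpace (𝓡 n) x)

/-- The Riemannian distance of `g`, with values in `[0, ∞]`: the infimum of the `g`-lengths of the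
`C^1` paths from `x` to `y`. -/
noncomputable def SmoothRiemannianMetric.edist (g : SmoothRiemannianMetric n X) (x y : X) : ℝ≥0∞ :=
  letI : RiemannianBundle (fun x : X => TangentSpace (𝓡 n) x) := ⟨g.toRiemannianMetric⟩
  Manifold.riemannianEDist (𝓡 n) x y

/-- On a connected manifold the Riemannian distance is finite. -/
theorem SmoothRiemannianMetric.edist_ne_top [ConnectedSpace X] (g : SmoothRiemannianMetric n X)
    (x y : X) : SmoothRiemannianMetric.edist g x y ≠ ⊤ := by
  let : RiemannianBundle (fun x : X => TangentSpace (𝓡 n) x) := ⟨g.toRiemannianMetric⟩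
  have : IsContMDiffRiemannianBundle (𝓡 n) ∞ (EuclideanSpace ℝ (Fin n))
    (fun x : X => TangentSpace (𝓡 n) x) := ⟨g.inner, g.contMDiff, fun _ _ _ => rfl⟩
  have : IsContinuousRiemannianBundle (EuclideanSpace ℝ (Fin n))
    (fun x : X => TangentSpace (𝓡 n) x) :=
    ⟨g.inner, g.contMDiff.continuous, fun _ _ _ => rfl⟩
  let A : Set X := {y | Manifold.riemannianEDist (𝓡 n) x y < ⊤}
  have key : ∀ z : X, ∀ᶠ w in 𝓝 z, Manifold.riemannianEDist (𝓡 n) z w < ⊤ := fun z =>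
    (eventually_riemannianEDist_lt (𝓡 n) z (c := 1) one_pos).mono
      fun w hw => hw.trans ENNReal.one_lt_top
  have hopen : IsOpen A := by
    rw [isOpen_iff_mem_nhds]
    intro z hz
    filter_upwards [key z] with w hw
    exact Manifold.riemannianEDist_triangle.trans_lt (ENNReal.add_lt_top.2 ⟨hz, hw⟩)
  have hclosed : IsClosed A := by
    rw [← isOpen_compl_iff, isOpen_iff_mem_nhds]
    intro z hz
    filter_upwards [key z] with w hw hw'
    apply hz
    refine Manifold.riemannianEDist_triangle.trans_lt (ENNReal.add_lt_top.2 ⟨hw', ?_⟩)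
    rwa [Manifold.riemannianEDist_comm]
  have hx : x ∈ A := by
    change Manifold.riemannianEDist (𝓡 n) x x < ⊤
    rw [Manifold.riemannianEDist_self]
    exact ENNReal.zero_lt_top
  have huniv : A = univ := IsClopen.eq_univ ⟨hclosed, hopen⟩ ⟨x, hx⟩
  have hy : y ∈ A := huniv ▸ mem_univ y
  exact ne_of_lt hy

/-- The metric `d_g` on the connected (Hausdorff) manifold `X` induced by the Riemannian metric `g`,
so that `(X, d_g)` is a Riemannian manifold regarded as a metric space. Its topology is the one of
the manifold. -/
@[reducible] noncomputable def SmoothRiemannianMetric.metricSpace [T3Space X] [ConnectedSpace X]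
    (g : SmoothRiemannianMetric n X) : MetricSpace X :=
  letI : RiemannianBundle (fun x : X => TangentSpace (𝓡 n) x) := ⟨g.toRiemannianMetric⟩
  haveI : IsContinuousRiemannianBundle (EuclideanSpace ℝ (Fin n))
    (fun x : X => TangentSpace (𝓡 n) x) :=
    ⟨g.inner, g.contMDiff.continuous, fun _ _ _ => rfl⟩
  letI : EMetricSpace X := EMetricSpace.ofRiemannianMetric (𝓡 n) X
  EMetricSpace.toMetricSpace (SmoothRiemannianMetric.edist_ne_top g)

end RiemannianDistance

section MetricNotions

variable {X : Type u}

/-- The metric `d` is `η`-quasisymmetric to the metric `ρ` on the same set: the identity map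
`(X, d) → (X, ρ)` is an `η`-quasisymmetry. Here `η` is a homeomorphism of `[0, ∞)`. -/
def IsQuasisymmetric (η : ℝ≥0 ≃ₜ ℝ≥0) (d ρ : MetricSpace X) : Prop :=
  ∀ p q s : X, s ≠ q →
    ρ.dist p q ≤ (η (Real.toNNReal (d.dist p q / d.dist q s)) : ℝ) * ρ.dist q s

/-- The metrics `d` and `ρ` on the same set are locally isometric: the identity map
`(X, d) → (X, ρ)` is a local isometry, i.e. every point has a neighbourhood, open for both metrics,
on which the two metrics coincide. -/
def IsLocallyIsometric (d ρ : MetricSpace X) : Prop :=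
  ∀ x : X, ∃ U : Set X, x ∈ U ∧
    IsOpen[d.toUniformSpace.toTopologicalSpace] U ∧
    IsOpen[ρ.toUniformSpace.toTopologicalSpace] U ∧
    ∀ p ∈ U, ∀ q ∈ U, d.dist p q = ρ.dist p q

/-- The Gromov-Hausdorff distance between the metric spaces `(X, dX)` and `(Y, dY)`, with values in
`[0, ∞]`: the infimal Hausdorff distance between `f(X)` and `g(Y)` over all metric spaces `Z` and
all isometric embeddings `f : X → Z` and `g : Y → Z`. (Only `f(X) ∪ g(Y)` matters, so it is enough
to take `Z` in the universe of `X` and `Y`.) -/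
noncomputable def gromovHausdorffEDist {X Y : Type u} (dX : MetricSpace X) (dY : MetricSpace Y) :
    ℝ≥0∞ :=
  ⨅ (Z : Type u) (_ : MetricSpace Z) (f : X → Z) (g : Y → Z) (_ : Isometry f) (_ : Isometry g),
    Metric.hausdorffEDist (range f) (range g)

end MetricNotions

/-!
Fix a small `ε > 0`, and let `δ x` be the `d_g`-radius around `x` at which balls acquire `d`-diameter
`ε` (`naturalScale`). This function is positive and `1`-Lipschitz for `d_g`, so it varies by
at most a factor `3` on the ball of radius `δ x / 2` around `x`, and there is a smooth `φ` with
`3 ε / δ ≤ φ ≤ 6 ε / δ`. In the conformal metric `h = φ ^ 2 • g`, each ball of `d_g`-radius `δ x / 2`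
has size about `ε`, as it has for `d`; a path that leaves it from its centre has `h`-length at least
`ε`, while `d` moves by less than `ε`. Counting the exits of a path gives `d ≤ d_h + ε`
(`dist_le_dist_add_of_exit`).

The distance `d_h` may be far larger than `d` at large scale, since `d` need not be a length metric.
The metric `ρ` (`spliceMetric`) repairs this: one travels along `d_h`, and may at the price `2 ε` use
a shortcut of `d`-length. Because `d ≤ d_h + ε`, two shortcuts never beat one, so that `ρ` is a
metric with `d - ε ≤ ρ ≤ d + 2 ε`, which gives the Gromov-Hausdorff convergence as `ε → 0`. Because a
shortcut costs at least `2 ε`, the metrics `ρ` and `d_h` coincide below that scale, which gives the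
local isometry.

Finally `ρ` is comparable to `(ε / δ x) d_g` at distances from `x` below `δ x`, and to `d` above.
For quasisymmetry, two points are compared as seen from a third: if both lie below the scale this is
linear, if both lie above it follows from the quasisymmetry of `d`, and in the mixed cases one passes
through an intermediate point at distance about `δ x`, where both descriptions agree
(`isQuasisymmetric_distortion`). The constants depend only on `η`, not even on the dimension.
-/

/-! ### Lengths of paths and conformal changes of a Riemannian metric -/

namespace SmoothRiemannianMetric

variable {n : ℕ} {X : Type u} [TopologicalSpace X]
  [ChartedSpace (EuclideanSpace ℝ (Fin n)) X] [IsManifold (𝓡 n) ∞ X]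

/-- The `g`-length of the restriction of a path to `[a, b]`. -/
noncomputable def length (g : SmoothRiemannianMetric n X) (γ : ℝ → X) (a b : ℝ) : ℝ≥0∞ :=
  letI : RiemannianBundle (fun x : X => TangentSpace (𝓡 n) x) := ⟨g.toRiemannianMetric⟩
  Manifold.pathELength (𝓡 n) γ a b

theorem length_eq_lintegral (g : SmoothRiemannianMetric n X) (γ : ℝ → X) (a b : ℝ) :
    g.length γ a b = ∫⁻ t in Icc a b,
      ENNReal.ofReal √(g.inner (γ t) (mfderiv 𝓘(ℝ, ℝ) (𝓡 n) γ t (1 : ℝ))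
        (mfderiv 𝓘(ℝ, ℝ) (𝓡 n) γ t (1 : ℝ))) := by
  let : RiemannianBundle (fun x : X => TangentSpace (𝓡 n) x) := ⟨g.toRiemannianMetric⟩
  unfold length
  rw [Manifold.pathELength_eq_lintegral_mfderiv_Icc]
  refine MeasureTheory.lintegral_congr fun t => ?_
  rw [← ofReal_norm]
  congr 1

theorem length_add (g : SmoothRiemannianMetric n X) (γ : ℝ → X) {a b c : ℝ} (hab : a ≤ b)
    (hbc : b ≤ c) : g.length γ a b + g.length γ b c = g.length γ a c :=
  let : RiemannianBundle (fun x : X => TangentSpace (𝓡 n) x) := ⟨g.toRiemannianMetric⟩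
  Manifold.pathELength_add hab hbc

theorem edist_le_length (g : SmoothRiemannianMetric n X) {γ : ℝ → X} {a b : ℝ}
    (hγ : ContMDiffOn 𝓘(ℝ, ℝ) (𝓡 n) 1 γ (Icc a b)) (hab : a ≤ b) : edist g (γ a) (γ b) ≤ g.length γ a b :=
  let : RiemannianBundle (fun x : X => TangentSpace (𝓡 n) x) := ⟨g.toRiemannianMetric⟩
  Manifold.riemannianEDist_le_pathELength hγ rfl rfl hab

theorem exists_length_lt (g : SmoothRiemannianMetric n X) {x y : X} {r : ℝ≥0∞}
    (h : edist g x y < r) :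
    ∃ γ : ℝ → X, γ 0 = x ∧ γ 1 = y ∧ ContMDiffOn 𝓘(ℝ, ℝ) (𝓡 n) 1 γ (Icc 0 1) ∧ g.length γ 0 1 < r :=
  let : RiemannianBundle (fun x : X => TangentSpace (𝓡 n) x) := ⟨g.toRiemannianMetric⟩
  Manifold.exists_lt_of_riemannianEDist_lt h

theorem length_le_mul_length {g h : SmoothRiemannianMetric n X} {c : ℝ} (hc : 0 ≤ c) {γ : ℝ → X}
    {a b : ℝ} (hgh : ∀ t ∈ Icc a b, ∀ v : TangentSpace (𝓡 n) (γ t),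
      h.inner (γ t) v v ≤ c ^ 2 * g.inner (γ t) v v) :
    h.length γ a b ≤ ENNReal.ofReal c * g.length γ a b := by
  rw [length_eq_lintegral, length_eq_lintegral,
    ← MeasureTheory.lintegral_const_mul' _ _ ENNReal.ofReal_ne_top]
  refine MeasureTheory.setLIntegral_mono' measurableSet_Icc fun t ht => ?_
  rw [← ENNReal.ofReal_mul hc]
  refine ENNReal.ofReal_le_ofReal ?_
  calc _ ≤ √(c ^ 2 * g.inner (γ t) (mfderiv 𝓘(ℝ, ℝ) (𝓡 n) γ t (1 : ℝ))
        (mfderiv 𝓘(ℝ, ℝ) (𝓡 n) γ t (1 : ℝ))) :=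
        Real.sqrt_le_sqrt (hgh t ht _)
    _ = _ := by rw [Real.sqrt_mul (sq_nonneg c), Real.sqrt_sq hc]

theorem mul_length_le_length {g h : SmoothRiemannianMetric n X} {c : ℝ} (hc : 0 ≤ c) {γ : ℝ → X}
    {a b : ℝ} (hgh : ∀ t ∈ Icc a b, ∀ v : TangentSpace (𝓡 n) (γ t),
      c ^ 2 * g.inner (γ t) v v ≤ h.inner (γ t) v v) :
    ENNReal.ofReal c * g.length γ a b ≤ h.length γ a b := by
  rw [length_eq_lintegral, length_eq_lintegral,
    ← MeasureTheory.lintegral_const_mul' _ _ ENNReal.ofReal_ne_top]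
  refine MeasureTheory.setLIntegral_mono' measurableSet_Icc fun t ht => ?_
  rw [← ENNReal.ofReal_mul hc]
  refine ENNReal.ofReal_le_ofReal ?_
  calc _ = √(c ^ 2 * g.inner (γ t) (mfderiv 𝓘(ℝ, ℝ) (𝓡 n) γ t (1 : ℝ))
        (mfderiv 𝓘(ℝ, ℝ) (𝓡 n) γ t (1 : ℝ))) := by
        rw [Real.sqrt_mul (sq_nonneg c), Real.sqrt_sq hc]
    _ ≤ _ := Real.sqrt_le_sqrt (hgh t ht _)

theorem inner_self_nonneg (g : SmoothRiemannianMetric n X) (x : X) (v : TangentSpace (𝓡 n) x) :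
    0 ≤ g.inner x v v := by
  rcases eq_or_ne v 0 with rfl | hv
  · simp
  · exact (g.pos x v hv).le

/-- The conformal metric `φ ^ 2 • g`, for a smooth positive function `φ`. -/
noncomputable def conformal (g : SmoothRiemannianMetric n X) (φ : X → ℝ)
    (hφ : ContMDiff (𝓡 n) 𝓘(ℝ, ℝ) ∞ φ) (hpos : ∀ x, 0 < φ x) : SmoothRiemannianMetric n X where
  inner x := φ x ^ 2 • g.inner x
  symm x v w := by simp [g.symm x v w]
  pos x v hv := by
    have := g.pos x v hv
    have := hpos x
    change 0 < φ x ^ 2 * g.inner x v v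
    positivity
  isVonNBounded x := by
    have key := (g.isVonNBounded x).image
      ((φ x)⁻¹ • ContinuousLinearMap.id ℝ (TangentSpace (𝓡 n) x))
    refine key.subset (fun v hv => ?_)
    refine ⟨φ x • v, ?_, ?_⟩
    · have : φ x ^ 2 * g.inner x v v < 1 := hv
      simpa [sq, mul_assoc] using this
    · simp [smul_smul, (hpos x).ne']
  contMDiff := by
    have : ∀ x : X, ContinuousAdd (TangentSpace (𝓡 n) x →L[ℝ] ℝ) := fun x =>
      inferInstanceAs (ContinuousAdd (EuclideanSpace ℝ (Fin n) →L[ℝ] ℝ))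
    exact (hφ.pow 2).smul_section g.contMDiff

@[simp] theorem conformal_inner (g : SmoothRiemannianMetric n X) {φ : X → ℝ}
    (hφ : ContMDiff (𝓡 n) 𝓘(ℝ, ℝ) ∞ φ) (hpos : ∀ x, 0 < φ x) (x : X) (v : TangentSpace (𝓡 n) x) :
    (g.conformal φ hφ hpos).inner x v v = φ x ^ 2 * g.inner x v v := rfl

section Connected
variable [T3Space X] [ConnectedSpace X]

theorem ofReal_dist (g : SmoothRiemannianMetric n X) (x y : X) :
    ENNReal.ofReal (g.metricSpace.dist x y) = edist g x y :=
  ENNReal.ofReal_toReal (g.edist_ne_top x y)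

theorem continuous_dist (g : SmoothRiemannianMetric n X) (x : X) :
    Continuous fun y => g.metricSpace.dist x y := by
  let := g.metricSpace
  exact continuous_const.dist continuous_id

theorem dist_le_of_edist_le {g : SmoothRiemannianMetric n X} {x y : X} {r : ℝ} (hr : 0 ≤ r)
    (h : edist g x y ≤ ENNReal.ofReal r) : g.metricSpace.dist x y ≤ r := by
  rwa [← ofReal_dist, ENNReal.ofReal_le_ofReal_iff hr] at h
theorem dist_lt_of_length_lt (g : SmoothRiemannianMetric n X) {γ : ℝ → X} {a b t r : ℝ}
    (hγ : ContMDiffOn 𝓘(ℝ, ℝ) (𝓡 n) 1 γ (Icc a b)) (ht : t ∈ Icc a b)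
    (hr : g.length γ a b < ENNReal.ofReal r) : g.metricSpace.dist (γ a) (γ t) < r := by
  have h1 : edist g (γ a) (γ t) ≤ g.length γ a t :=
    g.edist_le_length (hγ.mono (Icc_subset_Icc_right ht.2)) ht.1
  have h2 : g.length γ a t ≤ g.length γ a b :=
    (g.length_add γ ht.1 ht.2) ▸ le_self_add
  have h3 := (h1.trans h2).trans_lt hr
  rw [← ofReal_dist] at h3
  exact (ENNReal.ofReal_lt_ofReal_iff_of_nonneg
    (@dist_nonneg X g.metricSpace.toPseudoMetricSpace _ _)).1 h3

/-- If `h ≤ C ^ 2 • g` on a `g`-ball, then `d_h ≤ C d_g` from the centre to any point of the ball: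
almost shortest `g`-paths from the centre stay in the ball. -/
theorem dist_le_mul_dist {g h : SmoothRiemannianMetric n X} {C r : ℝ} (hC : 0 ≤ C) {x y : X}
    (hxy : g.metricSpace.dist x y < r)
    (H : ∀ z, g.metricSpace.dist x z < r → ∀ v : TangentSpace (𝓡 n) z,
      h.inner z v v ≤ C ^ 2 * g.inner z v v) :
    h.metricSpace.dist x y ≤ C * g.metricSpace.dist x y := by
  have hnn : 0 ≤ g.metricSpace.dist x y := @dist_nonneg X g.metricSpace.toPseudoMetricSpace _ _
  have key : ∀ s ∈ Ioo (g.metricSpace.dist x y) r, h.metricSpace.dist x y ≤ C * s := by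
    intro s hs
    have hs0 : 0 ≤ s := hnn.trans hs.1.le
    obtain ⟨γ, rfl, rfl, hγ, hlen⟩ := g.exists_length_lt (x := x) (y := y) (r := ENNReal.ofReal s)
      (by rw [← ofReal_dist]; exact (ENNReal.ofReal_lt_ofReal_iff_of_nonneg hnn).2 hs.1)
    refine dist_le_of_edist_le (by positivity) ?_
    calc edist h (γ 0) (γ 1) ≤ h.length γ 0 1 := h.edist_le_length hγ zero_le_one
      _ ≤ ENNReal.ofReal C * g.length γ 0 1 := length_le_mul_length hC fun t ht =>
          H _ ((g.dist_lt_of_length_lt hγ ht hlen).trans hs.2)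
      _ ≤ ENNReal.ofReal C * ENNReal.ofReal s := by gcongr
      _ = _ := (ENNReal.ofReal_mul hC).symm
  have hlim : Tendsto (fun s => C * s) (𝓝[>] g.metricSpace.dist x y)
      (𝓝 (C * g.metricSpace.dist x y)) :=
    (continuous_const.mul continuous_id).continuousWithinAt
  exact ge_of_tendsto hlim (eventually_of_mem (Ioo_mem_nhdsGT hxy) key)

/-- If `c ^ 2 • g ≤ h` on a closed `g`-ball, then a path that leaves the ball from its centre pays
at least `c` times the radius before it exits. -/
theorem exists_dist_eq_and_add_dist_lt {g h : SmoothRiemannianMetric n X} {c r L : ℝ} (hc : 0 ≤ c)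
    (hr : 0 ≤ r) {x y : X} (hxy : r ≤ g.metricSpace.dist x y)
    (H : ∀ z, g.metricSpace.dist x z ≤ r → ∀ v : TangentSpace (𝓡 n) z,
      c ^ 2 * g.inner z v v ≤ h.inner z v v) (hL : h.metricSpace.dist x y < L) :
    ∃ z, g.metricSpace.dist x z = r ∧ c * r + h.metricSpace.dist z y < L := by
  have hnn (a b) : 0 ≤ h.metricSpace.dist a b := @dist_nonneg X h.metricSpace.toPseudoMetricSpace a b
  obtain ⟨γ, rfl, rfl, hγ, hlen⟩ := h.exists_length_lt (x := x) (y := y) (r := ENNReal.ofReal L)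
    (by rw [← ofReal_dist]; exact (ENNReal.ofReal_lt_ofReal_iff_of_nonneg (hnn _ _)).2 hL)
  set f : ℝ → ℝ := fun t => g.metricSpace.dist (γ 0) (γ t)
  have hfc : ContinuousOn f (Icc 0 1) := (g.continuous_dist (γ 0)).comp_continuousOn hγ.continuousOn
  have hf0 : f 0 = 0 := @dist_self X g.metricSpace.toPseudoMetricSpace _
  -- the exit time is the first time at which the distance to the centre is `r`
  obtain ⟨t, ⟨ht, hft⟩, hmin⟩ : ∃ t, IsLeast (Icc 0 1 ∩ f ⁻¹' Ici r) t :=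
    (isCompact_Icc.of_isClosed_subset (hfc.preimage_isClosed_of_isClosed isClosed_Icc isClosed_Ici)
      inter_subset_left).exists_isLeast ⟨1, right_mem_Icc.2 zero_le_one, hxy⟩
  have hbefore : ∀ s ∈ Icc 0 t, f s ≤ r := by
    intro s hs
    by_contra! hlt
    obtain ⟨u, hu, hfu⟩ : r ∈ f '' Icc 0 s :=
      intermediate_value_Icc hs.1 (hfc.mono (Icc_subset_Icc_right (hs.2.trans ht.2)))
        ⟨hf0.trans_le hr, hlt.le⟩
    have htu : t ≤ u := hmin ⟨⟨hu.1, hu.2.trans (hs.2.trans ht.2)⟩, hfu.ge⟩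
    have : u = s := le_antisymm hu.2 (hs.2.trans htu)
    exact hlt.ne' (this ▸ hfu)
  have hftr : f t = r := le_antisymm (hbefore t ⟨ht.1, le_rfl⟩) hft
  refine ⟨γ t, hftr, ?_⟩
  have h1 : ENNReal.ofReal (c * r) ≤ h.length γ 0 t := by
    calc ENNReal.ofReal (c * r) = ENNReal.ofReal c * edist g (γ 0) (γ t) := by
          rw [ENNReal.ofReal_mul hc, ← ofReal_dist, ← hftr]
      _ ≤ ENNReal.ofReal c * g.length γ 0 t := by
          gcongr
          exact g.edist_le_length (hγ.mono (Icc_subset_Icc_right ht.2)) ht.1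
      _ ≤ _ := mul_length_le_length hc fun s hs => H _ (hbefore s hs)
  have h2 : edist h (γ t) (γ 1) ≤ h.length γ t 1 :=
    h.edist_le_length (hγ.mono (Icc_subset_Icc_left ht.1)) ht.2
  have h3 : ENNReal.ofReal (c * r + h.metricSpace.dist (γ t) (γ 1)) < ENNReal.ofReal L := by
    rw [ENNReal.ofReal_add (by positivity) (hnn _ _), ofReal_dist]
    exact (add_le_add h1 h2).trans_lt (h.length_add γ ht.1 ht.2 ▸ hlen)
  exact (ENNReal.ofReal_lt_ofReal_iff_of_nonneg (add_nonneg (by positivity) (hnn _ _))).1 h3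

end Connected
end SmoothRiemannianMetric

/-! ### Splicing two metrics at a given scale -/

section Splice

variable {X : Type u}

/-- The infimum of `e x y + d y w + e w z` over all `y` and `w`: a detour that uses the metric `d`
once, between two excursions in the metric `e`. -/
noncomputable def detourDist (e d : MetricSpace X) (x z : X) : ℝ :=
  ⨅ p : X × X, (e.dist x p.1 + d.dist p.1 p.2 + e.dist p.2 z)

theorem detourDist_le (e d : MetricSpace X) (x y w z : X) :
    detourDist e d x z ≤ e.dist x y + d.dist y w + e.dist w z := by
  refine ciInf_le (f := fun p : X × X => e.dist x p.1 + d.dist p.1 p.2 + e.dist p.2 z)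
    ⟨0, ?_⟩ (y, w)
  rintro _ ⟨p, rfl⟩
  have h1 := @dist_nonneg X e.toPseudoMetricSpace x p.1
  have h2 := @dist_nonneg X d.toPseudoMetricSpace p.1 p.2
  have h3 := @dist_nonneg X e.toPseudoMetricSpace p.2 z
  exact add_nonneg (add_nonneg h1 h2) h3

theorem le_detourDist {e d : MetricSpace X} {x z : X} {a : ℝ}
    (h : ∀ y w, a ≤ e.dist x y + d.dist y w + e.dist w z) : a ≤ detourDist e d x z :=
  have : Nonempty (X × X) := ⟨(x, x)⟩
  le_ciInf fun p => h p.1 p.2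

theorem detourDist_nonneg (e d : MetricSpace X) (x z : X) : 0 ≤ detourDist e d x z :=
  le_detourDist fun y w =>
    add_nonneg (add_nonneg (@dist_nonneg X e.toPseudoMetricSpace x y)
      (@dist_nonneg X d.toPseudoMetricSpace y w)) (@dist_nonneg X e.toPseudoMetricSpace w z)

theorem detourDist_comm (e d : MetricSpace X) (x z : X) :
    detourDist e d x z = detourDist e d z x := by
  have key : ∀ x z, detourDist e d x z ≤ detourDist e d z x := fun x z =>
    le_detourDist fun y w => by
      refine (detourDist_le e d x w y z).trans_eq ?_
      rw [e.dist_comm x w, d.dist_comm w y, e.dist_comm y z]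
      ring
  exact le_antisymm (key x z) (key z x)

theorem detourDist_le_dist_add (e d : MetricSpace X) (x y z : X) :
    detourDist e d x z ≤ e.dist x y + detourDist e d y z := by
  rw [← sub_le_iff_le_add']
  refine le_detourDist fun u w => ?_
  have h1 := detourDist_le e d x u w z
  have h2 := e.dist_triangle x y u
  linarith

variable {e d : MetricSpace X} {ε : ℝ}

/-- If `d ≤ e + ε`, then two successive detours can be replaced by one, at the cost of an additive
error `ε`. -/
theorem detourDist_triangle (hde : ∀ x y, d.dist x y ≤ e.dist x y + ε) (x y z : X) :
    detourDist e d x z ≤ detourDist e d x y + detourDist e d y z + ε := by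
  have : detourDist e d x z - ε - detourDist e d x y ≤ detourDist e d y z := by
    refine le_detourDist fun y' w' => ?_
    have : detourDist e d x z - ε - (e.dist y y' + d.dist y' w' + e.dist w' z) ≤
        detourDist e d x y := by
      refine le_detourDist fun u w => ?_
      have h1 := detourDist_le e d x u w' z
      have h2 := d.dist_triangle u w w'
      have h3 := d.dist_triangle w y' w'
      have h4 := hde w y'
      have h5 := e.dist_triangle w y y'
      linarith
    linarith
  linarith

theorem dist_le_detourDist (hde : ∀ x y, d.dist x y ≤ e.dist x y + ε) (x z : X) :
    d.dist x z ≤ detourDist e d x z + 2 * ε := by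
  rw [← sub_le_iff_le_add]
  refine le_detourDist fun y w => ?_
  have h1 := d.dist_triangle x y z
  have h2 := d.dist_triangle y w z
  have h3 := hde x y
  have h4 := hde w z
  linarith

/-- The metric which agrees with `e` below the scale `2 ε` and is within `2 ε` of `d`, provided that
`d ≤ e + ε`: a point moves along `e`, and may use a shortcut along `d` at the price `2 ε`. -/
@[reducible] noncomputable def spliceMetric (e d : MetricSpace X) (ε : ℝ) (hε : 0 < ε)
    (hde : ∀ x y, d.dist x y ≤ e.dist x y + ε) : MetricSpace X where
  dist x z := min (e.dist x z) (detourDist e d x z + 2 * ε)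
  dist_self x := by
    have h := detourDist_nonneg e d x x
    rw [e.dist_self, min_eq_left (by linarith)]
  dist_comm x z := by rw [e.dist_comm, detourDist_comm]
  dist_triangle x y z := by
    have h1 := e.dist_triangle x y z
    have h2 := detourDist_triangle hde x y z
    have h3 := detourDist_le_dist_add e d x y z
    have h4 := detourDist_le_dist_add e d z y x
    rw [detourDist_comm e d z x, detourDist_comm e d y x, e.dist_comm z y] at h4
    rcases min_choice (e.dist x y) (detourDist e d x y + 2 * ε) with h | h <;>
    rcases min_choice (e.dist y z) (detourDist e d y z + 2 * ε) with h' | h' <;>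
    rw [h, h']
    · exact (min_le_left _ _).trans h1
    all_goals refine (min_le_right _ _).trans ?_; linarith
  eq_of_dist_eq_zero {x z} h := by
    have h1 := detourDist_nonneg e d x z
    rcases min_choice (e.dist x z) (detourDist e d x z + 2 * ε) with h' | h' <;> rw [h'] at h
    · exact e.eq_of_dist_eq_zero h
    · linarith

variable (hε : 0 < ε) (hde : ∀ x y, d.dist x y ≤ e.dist x y + ε)

theorem spliceMetric_dist_le_left (x z : X) :
    (spliceMetric e d ε hε hde).dist x z ≤ e.dist x z :=
  min_le_left _ _

theorem spliceMetric_dist_le_add (x z : X) :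
    (spliceMetric e d ε hε hde).dist x z ≤ d.dist x z + 2 * ε := by
  refine (min_le_right _ _).trans ?_
  have h := detourDist_le e d x x z z
  rw [e.dist_self, e.dist_self] at h
  linarith

theorem dist_le_spliceMetric_dist_add (x z : X) :
    d.dist x z ≤ (spliceMetric e d ε hε hde).dist x z + ε := by
  rw [← sub_le_iff_le_add]
  have h1 := dist_le_detourDist hde x z
  have h2 := hde x z
  exact le_min (by linarith) (by linarith)

theorem min_le_spliceMetric_dist (x z : X) :
    min (e.dist x z) (2 * ε) ≤ (spliceMetric e d ε hε hde).dist x z :=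
  min_le_min_left _ (by linarith [detourDist_nonneg e d x z])

theorem spliceMetric_dist_eq {x z : X} (h : e.dist x z < 2 * ε) :
    (spliceMetric e d ε hε hde).dist x z = e.dist x z :=
  min_eq_left (by linarith [detourDist_nonneg e d x z])

theorem isLocallyIsometric_spliceMetric :
    IsLocallyIsometric (spliceMetric e d ε hε hde) e := by
  intro x
  have hiff (y) : e.dist y x < ε ↔ (spliceMetric e d ε hε hde).dist y x < ε := by
    refine ⟨fun h => (spliceMetric_dist_le_left hε hde y x).trans_lt h, fun h => ?_⟩
    have h' := (min_le_spliceMetric_dist hε hde y x).trans_lt h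
    exact (min_lt_iff.1 h').resolve_right (by linarith)
  refine ⟨{y | e.dist y x < ε}, ?_, ?_, ?_, ?_⟩
  · change e.dist x x < ε
    rwa [e.dist_self]
  · simp_rw [hiff]
    exact @Metric.isOpen_ball X (spliceMetric e d ε hε hde).toPseudoMetricSpace x ε
  · exact @Metric.isOpen_ball X e.toPseudoMetricSpace x ε
  · intro p hp q hq
    refine spliceMetric_dist_eq hε hde ?_
    have h1 := e.dist_triangle p x q
    rw [e.dist_comm x q] at h1
    have hp' : e.dist p x < ε := hp
    have hq' : e.dist q x < ε := hq
    linarith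

end Splice

theorem gromovHausdorffEDist_le {X : Type u} [Nonempty X] (ρ d : MetricSpace X) {ε : ℝ}
    (hε : 0 < ε) (h : ∀ x y, |ρ.dist x y - d.dist x y| ≤ 2 * ε) :
    gromovHausdorffEDist ρ d ≤ ENNReal.ofReal ε := by
  let Z : MetricSpace (X ⊕ X) := @Metric.glueMetricApprox X X X ρ d _ id id ε hε h
  have key (x : X) : @EDist.edist _ Z.toEDist (Sum.inl x) (Sum.inr x) ≤ ENNReal.ofReal ε := by
    rw [edist_dist]
    refine ENNReal.ofReal_le_ofReal ?_
    exact (@Metric.glueDist_glued_points X X X ρ d _ id id ε x).le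
  refine iInf_le_of_le (X ⊕ X) (iInf_le_of_le Z (iInf_le_of_le Sum.inl (iInf_le_of_le Sum.inr
    (iInf_le_of_le ?_ (iInf_le_of_le ?_ ?_)))))
  · exact @Isometry.of_dist_eq X (X ⊕ X) ρ.toPseudoMetricSpace _ _ fun x y => rfl
  · exact @Isometry.of_dist_eq X (X ⊕ X) d.toPseudoMetricSpace _ _ fun x y => rfl
  · refine Metric.hausdorffEDist_le_of_mem_edist ?_ ?_
    · rintro _ ⟨x, rfl⟩
      exact ⟨_, mem_range_self x, key x⟩
    · rintro _ ⟨x, rfl⟩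
      exact ⟨_, mem_range_self x, by rw [edist_comm]; exact key x⟩

/-! ### Homeomorphisms of `[0, ∞)` and the control function -/

theorem Homeomorph.strictMono_nnreal (η : ℝ≥0 ≃ₜ ℝ≥0) : StrictMono η := by
  rcases η.continuous.strictMono_of_inj η.injective with h | h
  · exact h
  · obtain ⟨t, ht⟩ := η.surjective (η 0 + 1)
    have h1 : η t ≤ η 0 := h.antitone zero_le
    rw [ht] at h1
    exact absurd h1 (lt_add_one _).not_ge

theorem Homeomorph.nnreal_apply_zero (η : ℝ≥0 ≃ₜ ℝ≥0) : η 0 = 0 := by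
  obtain ⟨t, ht⟩ := η.surjective 0
  have h : η 0 ≤ η t := η.strictMono_nnreal.monotone zero_le
  rw [ht] at h
  exact le_antisymm h zero_le

/-- The function `η` as a function on `ℝ`, constant on the negative half-line. -/
noncomputable def realControl (η : ℝ≥0 ≃ₜ ℝ≥0) (t : ℝ) : ℝ := η t.toNNReal

theorem realControl_mono (η : ℝ≥0 ≃ₜ ℝ≥0) : Monotone (realControl η) := fun _ _ h =>
  NNReal.coe_le_coe.2 (η.strictMono_nnreal.monotone (Real.toNNReal_mono h))

theorem realControl_nonneg (η : ℝ≥0 ≃ₜ ℝ≥0) (t : ℝ) : 0 ≤ realControl η t := NNReal.coe_nonneg _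

/-- The point at which `η` takes the value `1 / 4`. It bounds from below the `d`-distance to points
beyond the natural scale, in units of that scale. -/
noncomputable def quarterPoint (η : ℝ≥0 ≃ₜ ℝ≥0) : ℝ≥0 := η.symm (1 / 4)

theorem quarterPoint_pos (η : ℝ≥0 ≃ₜ ℝ≥0) : 0 < quarterPoint η := by
  refine pos_iff_ne_zero.2 fun h => ?_
  have h1 : η (quarterPoint η) = 1 / 4 := η.apply_symm_apply _
  rw [h, η.nnreal_apply_zero] at h1
  norm_num at h1

theorem quarterPoint_le {η : ℝ≥0 ≃ₜ ℝ≥0} {t : ℝ} (h : 1 / 4 ≤ realControl η t) :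
    (quarterPoint η : ℝ) ≤ t := by
  have h1 : η (quarterPoint η) ≤ η t.toNNReal := by
    rw [quarterPoint, η.apply_symm_apply, ← NNReal.coe_le_coe]
    simpa [realControl] using h
  have h2 := η.strictMono_nnreal.le_iff_le.1 h1
  exact (Real.le_toNNReal_iff_coe_le' (quarterPoint_pos η)).1 h2

/-- A constant such that `d + 2 ε` is at most `distortionConst η * d` beyond the natural scale. -/
noncomputable def distortionConst (η : ℝ≥0 ≃ₜ ℝ≥0) : ℝ≥0 := 1 + 4 / quarterPoint η

/-- The underlying function of the control function `η'`. Each summand handles one of the possible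
positions of two points relative to the natural scale at a third point. -/
noncomputable def distortionFun (η : ℝ≥0 ≃ₜ ℝ≥0) (t : ℝ≥0) : ℝ≥0 :=
  6 * t + η (2 * distortionConst η * t) +
    NNReal.sqrt (distortionConst η * t) * η (2 / quarterPoint η) +
    6 * η (NNReal.sqrt (distortionConst η * t)) + 24 * t * η (24 * t)

theorem distortionFun_strictMono (η : ℝ≥0 ≃ₜ ℝ≥0) : StrictMono (distortionFun η) := by
  intro s t h
  have hη := η.strictMono_nnreal.monotone
  have h1 : 6 * s < 6 * t := by gcongr
  have h2 : η (2 * distortionConst η * s) ≤ η (2 * distortionConst η * t) := hη (by gcongr)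
  have h3 : NNReal.sqrt (distortionConst η * s) ≤ NNReal.sqrt (distortionConst η * t) :=
    NNReal.sqrt.monotone (by gcongr)
  have h4 := hη h3
  have h5 : η (24 * s) ≤ η (24 * t) := hη (by gcongr)
  exact add_lt_add_of_lt_of_le (add_lt_add_of_lt_of_le (add_lt_add_of_lt_of_le
    (add_lt_add_of_lt_of_le h1 h2) (mul_le_mul_left h3 _)) (mul_le_mul_right h4 _))
    (mul_le_mul' (mul_le_mul_right h.le _) h5)

theorem distortionFun_surjective (η : ℝ≥0 ≃ₜ ℝ≥0) : Function.Surjective (distortionFun η) := by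
  intro y
  have hc : Continuous (distortionFun η) := by
    unfold distortionFun
    have := η.continuous
    fun_prop
  have h0 : distortionFun η 0 = 0 := by simp [distortionFun, η.nnreal_apply_zero]
  have hy : y ≤ distortionFun η y := by
    calc y ≤ 6 * y := le_mul_of_one_le_left zero_le (by norm_num)
      _ ≤ _ := by
        unfold distortionFun
        rw [add_assoc, add_assoc, add_assoc]
        exact le_self_add
  obtain ⟨t, -, ht⟩ := intermediate_value_Icc zero_le hc.continuousOn
    ⟨h0.trans_le zero_le, hy⟩
  exact ⟨t, ht⟩

/-- The control function `η'`. -/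
noncomputable def distortion (η : ℝ≥0 ≃ₜ ℝ≥0) : ℝ≥0 ≃ₜ ℝ≥0 :=
  ((distortionFun_strictMono η).orderIsoOfSurjective _ (distortionFun_surjective η)).toHomeomorph

theorem realControl_distortion (η : ℝ≥0 ≃ₜ ℝ≥0) {t : ℝ} (ht : 0 ≤ t) :
    realControl (distortion η) t =
      6 * t + realControl η (2 * distortionConst η * t) +
      √(distortionConst η * t) * realControl η (2 / quarterPoint η) +
      6 * realControl η √(distortionConst η * t) + 24 * t * realControl η (24 * t) := by
  lift t to ℝ≥0 using ht
  have h (s : ℝ≥0) : realControl η s = η s := by simp [realControl]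
  have h1 : realControl (distortion η) t = distortionFun η t := by
    rw [realControl, Real.toNNReal_coe]
    rfl
  rw [h1, distortionFun]
  push_cast
  simp only [← h]
  push_cast
  rfl

/-! ### The natural scale at a point -/

section Scale

variable {X : Type u} {m d : MetricSpace X} {ε : ℝ} {η : ℝ≥0 ≃ₜ ℝ≥0}

/-- The infimal radius of an `m`-ball around `x` that contains two points at `d`-distance at least
`ε`. As an infimum over pairs of points, it is `1`-Lipschitz for `m`. -/
noncomputable def naturalScale (m d : MetricSpace X) (ε : ℝ) (x : X) : ℝ :=
  ⨅ p : {p : X × X // ε ≤ d.dist p.1 p.2}, max (m.dist x p.1.1) (m.dist x p.1.2)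

theorem naturalScale_le {x y z : X} (h : ε ≤ d.dist y z) :
    naturalScale m d ε x ≤ max (m.dist x y) (m.dist x z) := by
  refine ciInf_le (f := fun p : {p : X × X // ε ≤ d.dist p.1 p.2} =>
    max (m.dist x p.1.1) (m.dist x p.1.2)) ⟨0, ?_⟩ ⟨(y, z), h⟩
  rintro _ ⟨p, rfl⟩
  exact le_max_of_le_left (@dist_nonneg X m.toPseudoMetricSpace _ _)

theorem le_naturalScale (hne : ∃ y z, ε ≤ d.dist y z) {x : X} {r : ℝ}
    (h : ∀ y z, ε ≤ d.dist y z → r ≤ max (m.dist x y) (m.dist x z)) : r ≤ naturalScale m d ε x :=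
  have : Nonempty {p : X × X // ε ≤ d.dist p.1 p.2} :=
    let ⟨y, z, hyz⟩ := hne
    ⟨⟨(y, z), hyz⟩⟩
  le_ciInf fun p => h _ _ p.2

theorem naturalScale_le_add (hne : ∃ y z, ε ≤ d.dist y z) (x y : X) :
    naturalScale m d ε x ≤ naturalScale m d ε y + m.dist x y := by
  rw [← sub_le_iff_le_add]
  refine le_naturalScale hne fun u w h => ?_
  rw [sub_le_iff_le_add, ← max_add_add_right]
  refine (naturalScale_le h).trans (max_le_max ?_ ?_) <;>
  · rw [add_comm]
    exact m.dist_triangle _ _ _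

theorem dist_lt_of_lt_naturalScale {x y : X} (h : m.dist x y < naturalScale m d ε x) :
    d.dist x y < ε := by
  by_contra! hle
  refine (naturalScale_le hle).not_gt (max_lt ?_ h)
  rw [m.dist_self]
  exact (@dist_nonneg X m.toPseudoMetricSpace x y).trans_lt h

theorem exists_dist_le_two_mul_naturalScale (hne : ∃ y z, ε ≤ d.dist y z) {x : X}
    (hx : 0 < naturalScale m d ε x) :
    ∃ w, ε / 2 ≤ d.dist x w ∧ m.dist x w ≤ 2 * naturalScale m d ε x := by
  by_contra! hcon
  have : 2 * naturalScale m d ε x ≤ naturalScale m d ε x := by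
    refine le_naturalScale hne fun y z hyz => ?_
    have h1 := d.dist_triangle y x z
    rw [d.dist_comm y x] at h1
    rcases le_total (d.dist x z) (d.dist x y) with h | h
    · exact le_max_of_le_left (hcon y (by linarith)).le
    · exact le_max_of_le_right (hcon z (by linarith)).le
  linarith

theorem naturalScale_pos (hε : 0 < ε) (hd : IsQuasisymmetric η d m)
    (hne : ∃ y z, ε ≤ d.dist y z) (x : X) : 0 < naturalScale m d ε x := by
  obtain ⟨s, hs⟩ : ∃ s, s ≠ x := by
    obtain ⟨y, z, hyz⟩ := hne
    by_contra! h
    rw [h y, h z, d.dist_self] at hyz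
    linarith
  have hms : 0 < m.dist x s := (@dist_pos X m _ _).2 hs.symm
  set D := realControl η (d.dist s x / (ε / 2)) + 1
  have hDpos : 0 < D := add_pos_of_nonneg_of_pos (realControl_nonneg η _) one_pos
  have hds : 0 ≤ d.dist s x := @dist_nonneg X d.toPseudoMetricSpace s x
  have key (y : X) (hy : ε / 2 ≤ d.dist x y) : m.dist x s / D ≤ m.dist x y := by
    have hyx : y ≠ x := by
      rintro rfl
      rw [d.dist_self] at hy
      linarith
    have h1 := hd s x y hyx
    have h2 : realControl η (d.dist s x / d.dist x y) ≤ D :=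
      (realControl_mono η (by gcongr)).trans (le_add_of_nonneg_right zero_le_one)
    rw [div_le_iff₀ hDpos, m.dist_comm x s, mul_comm]
    exact h1.trans (mul_le_mul_of_nonneg_right h2 (@dist_nonneg X m.toPseudoMetricSpace x y))
  refine (div_pos hms hDpos).trans_le (le_naturalScale hne fun y z hyz => ?_)
  have h1 := d.dist_triangle y x z
  rw [d.dist_comm y x] at h1
  rcases le_total (d.dist x z) (d.dist x y) with h | h
  · exact le_max_of_le_left (key y (by linarith))
  · exact le_max_of_le_right (key z (by linarith))

end Scale

/-! ### Quasisymmetry of the spliced metric -/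

section Quasisymmetry

variable {X : Type u} {m d ρ : MetricSpace X} {ε : ℝ} {η : ℝ≥0 ≃ₜ ℝ≥0} {δ : X → ℝ}

/-- Suppose that `d` is quasisymmetric to `m`, and that `δ` is its natural scale at level `ε`. If
`ρ` is comparable to `(ε / δ) m` below the scale `δ` and to `d` above it, then `ρ` is quasisymmetric
to `m`, with a control function that depends only on that of `d`. -/
theorem isQuasisymmetric_distortion (hε : 0 < ε) (hδ : ∀ x, 0 < δ x)
    (hd : IsQuasisymmetric η d m)
    (hdsmall : ∀ x y, m.dist x y < δ x → d.dist x y < ε)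
    (hfar : ∀ x, ∃ w, ε / 2 ≤ d.dist x w ∧ m.dist x w ≤ 2 * δ x)
    (hmid : ∀ x y, δ x / 2 ≤ m.dist x y → ∃ w, m.dist x w = δ x / 2)
    (hupper : ∀ x y, m.dist x y < δ x / 2 → ρ.dist x y ≤ 12 * (ε / δ x) * m.dist x y)
    (hlower : ∀ x y, m.dist x y ≤ δ x / 2 → 2 * (ε / δ x) * m.dist x y ≤ ρ.dist x y)
    (hlarge : ∀ x y, δ x / 2 ≤ m.dist x y → ε ≤ ρ.dist x y)
    (hρd : ∀ x y, ρ.dist x y ≤ d.dist x y + 2 * ε)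
    (hdρ : ∀ x y, d.dist x y ≤ ρ.dist x y + ε) :
    IsQuasisymmetric (distortion η) ρ m := by
  intro p q s hs
  change _ ≤ realControl (distortion η) _ * _
  have hκ : (0 : ℝ) < quarterPoint η := quarterPoint_pos η
  have hη := realControl_mono η
  have hη0 := realControl_nonneg η
  have hmqs : 0 < m.dist q s := (@dist_pos X m _ _).2 hs.symm
  have hρqs : 0 < ρ.dist q s := (@dist_pos X ρ _ _).2 hs.symm
  have hdqs : 0 < d.dist q s := (@dist_pos X d _ _).2 hs.symm
  have hρpq : 0 ≤ ρ.dist q p := @dist_nonneg X ρ.toPseudoMetricSpace _ _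
  have hδq := hδ q
  obtain ⟨C, hC⟩ : ∃ C : ℝ, C = distortionConst η := ⟨_, rfl⟩
  have hCeq : C = 1 + 4 / quarterPoint η := by simp [hC, distortionConst]
  have hC0 : 0 < C := by rw [hCeq]; positivity
  have hdlarge (x : X) (hx : δ q / 2 ≤ m.dist q x) : quarterPoint η * (ε / 2) ≤ d.dist q x := by
    obtain ⟨w, hw1, hw2⟩ := hfar q
    have hwq : w ≠ q := by
      rintro rfl
      rw [d.dist_self] at hw1
      linarith
    have h1 : m.dist x q ≤ realControl η (d.dist x q / d.dist q w) * m.dist q w := hd x q w hwq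
    have h2 : (quarterPoint η : ℝ) ≤ d.dist x q / d.dist q w := by
      refine quarterPoint_le ?_
      by_contra! hlt
      rw [m.dist_comm x q] at h1
      have h3 := mul_le_mul_of_nonneg_left hw2 (hη0 (d.dist x q / d.dist q w))
      nlinarith
    rw [le_div_iff₀ (by linarith), d.dist_comm x q] at h2
    exact (mul_le_mul_of_nonneg_left hw1 hκ.le).trans h2
  have hρlarge (x : X) (hx : δ q / 2 ≤ m.dist q x) : ρ.dist q x ≤ C * d.dist q x := by
    have h1 := hdlarge x hx
    have h2 : 2 * ε ≤ 4 / quarterPoint η * d.dist q x := by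
      rw [div_mul_eq_mul_div, le_div_iff₀ hκ]
      linarith
    have h3 := hρd q x
    rw [hCeq, add_mul, one_mul]
    linarith
  have hd2 (x : X) (hx : δ q / 2 ≤ m.dist q x) : d.dist q x ≤ 2 * ρ.dist q x := by
    linarith [hlarge q x hx, hdρ q x]
  rw [m.dist_comm p q, ρ.dist_comm p q]
  set t := ρ.dist q p / ρ.dist q s with ht
  have ht0 : 0 ≤ t := by positivity
  have htmul : t * ρ.dist q s = ρ.dist q p := div_mul_cancel₀ _ hρqs.ne'
  have hk : 0 < ε / δ q := by positivity
  have hkδ : ε / δ q * δ q = ε := div_mul_cancel₀ _ hδq.ne'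
  rw [realControl_distortion η ht0, ← hC]
  have T1 : 0 ≤ 6 * t := by positivity
  have T2 := hη0 (2 * C * t)
  have T3 : 0 ≤ √(C * t) * realControl η (2 / quarterPoint η) :=
    mul_nonneg (Real.sqrt_nonneg _) (hη0 _)
  have T4 : 0 ≤ 6 * realControl η √(C * t) := mul_nonneg (by norm_num) (hη0 _)
  have T5 : 0 ≤ 24 * t * realControl η (24 * t) := mul_nonneg (by positivity) (hη0 _)
  suffices ∃ R, m.dist q p ≤ R * m.dist q s ∧ (R ≤ 6 * t ∨ R ≤ realControl η (2 * C * t) ∨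
      R ≤ √(C * t) * realControl η (2 / quarterPoint η) ∨ R ≤ 6 * realControl η √(C * t) ∨
      R ≤ 24 * t * realControl η (24 * t)) by
    obtain ⟨R, hR, hcases⟩ := this
    refine hR.trans (mul_le_mul_of_nonneg_right ?_ hmqs.le)
    rcases hcases with h | h | h | h | h <;> linarith
  rcases lt_or_ge (m.dist q p) (δ q / 2) with ha | ha <;>
  rcases lt_or_ge (m.dist q s) (δ q / 2) with hb | hb
  · refine ⟨6 * t, ?_, Or.inl le_rfl⟩
    have h1 := hlower q p ha.le
    have h2 := mul_le_mul_of_nonneg_left (hupper q s hb) ht0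
    rw [htmul] at h2
    refine le_of_mul_le_mul_left ?_ hk
    linarith
  · -- `p` is below the scale at `q` and `s` is above it: the scale itself is compared with both.
    obtain ⟨w, hw⟩ := hmid q s hb
    have hdw : d.dist q w < ε := hdsmall q w (by linarith)
    have h1 : m.dist w q ≤ realControl η (d.dist w q / d.dist q s) * m.dist q s := hd w q s hs
    rw [m.dist_comm w q, d.dist_comm w q, hw] at h1
    set u := ρ.dist q p / ε with hu
    set v := ε / d.dist q s with hv
    have hu0 : 0 ≤ u := by positivity
    have h2 : δ q / 2 ≤ realControl η v * m.dist q s :=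
      h1.trans (mul_le_mul_of_nonneg_right (hη (by rw [hv]; gcongr)) hmqs.le)
    have h3 := hlower q p ha.le
    have hmu : m.dist q p ≤ u * (δ q / 2) := by
      have : u * ε = ρ.dist q p := div_mul_cancel₀ _ hε.ne'
      refine le_of_mul_le_mul_left ?_ hk
      nlinarith
    have hu6 : u ≤ 6 := by
      rw [hu, div_le_iff₀ hε]
      have := hupper q p ha
      nlinarith
    have hv2 : v ≤ 2 / quarterPoint η := by
      rw [hv, div_le_div_iff₀ hdqs hκ]
      linarith [hdlarge s hb]
    have huv : u * v ≤ C * t := by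
      have : u * v = ρ.dist q p / d.dist q s := by
        rw [hu, hv]
        field_simp
      rw [this, ht, ← mul_div_assoc, div_le_div_iff₀ hdqs hρqs]
      have := mul_le_mul_of_nonneg_left (hρlarge s hb) hρpq
      linarith
    refine ⟨u * realControl η v, ?_, ?_⟩
    · rw [mul_assoc]
      exact hmu.trans (mul_le_mul_of_nonneg_left h2 hu0)
    · -- the smaller one of `u` and `v` is at most the square root of `u v`
      rcases le_or_gt u √(C * t) with h | h
      · exact Or.inr (Or.inr (Or.inl (mul_le_mul h (hη hv2) (hη0 _) (Real.sqrt_nonneg _))))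
      · refine Or.inr (Or.inr (Or.inr (Or.inl (mul_le_mul hu6 (hη ?_) (hη0 _) (by norm_num)))))
        have hsq : √(C * t) * √(C * t) = C * t := Real.mul_self_sqrt (by positivity)
        by_contra! hlt
        have := mul_lt_mul'' h hlt (Real.sqrt_nonneg _) (Real.sqrt_nonneg _)
        linarith
  · -- `p` is above the scale at `q` and `s` is below it: again the scale is compared with both.
    obtain ⟨w, hw1, hw2⟩ := hfar q
    have hwq : w ≠ q := by
      rintro rfl
      rw [d.dist_self] at hw1
      linarith
    have h1 : m.dist p q ≤ realControl η (d.dist p q / d.dist q w) * m.dist q w := hd p q w hwq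
    rw [m.dist_comm p q, d.dist_comm p q] at h1
    have hup := hupper q s hb
    have hρs : ρ.dist q s ≤ 6 * ε := by nlinarith
    have hεt : ε ≤ t * ρ.dist q s := htmul ▸ hlarge q p ha
    have h2 : d.dist q p / d.dist q w ≤ 24 * t := by
      rw [div_le_iff₀ (by linarith)]
      have h3 := hd2 p ha
      have h4 := mul_le_mul_of_nonneg_left hρs ht0
      have h5 := mul_le_mul_of_nonneg_left hw1 ht0
      linarith
    refine ⟨24 * t * realControl η (24 * t), ?_, Or.inr (Or.inr (Or.inr (Or.inr le_rfl)))⟩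
    have h3 : m.dist q p ≤ realControl η (24 * t) * (2 * δ q) :=
      h1.trans (mul_le_mul (hη h2) hw2 (@dist_nonneg X m.toPseudoMetricSpace _ _) (hη0 _))
    have h4 : δ q ≤ 12 * t * m.dist q s := by
      refine le_of_mul_le_mul_left ?_ hk
      have := mul_le_mul_of_nonneg_left hup ht0
      linarith
    have h5 := mul_le_mul_of_nonneg_left h4 (hη0 (24 * t))
    linarith
  · refine ⟨realControl η (2 * C * t), ?_, Or.inr (Or.inl le_rfl)⟩
    have h1 : m.dist p q ≤ realControl η (d.dist p q / d.dist q s) * m.dist q s := hd p q s hs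
    rw [m.dist_comm p q, d.dist_comm p q] at h1
    refine h1.trans (mul_le_mul_of_nonneg_right (hη ?_) hmqs.le)
    rw [div_le_iff₀ hdqs]
    have h2 := mul_le_mul_of_nonneg_left (hρlarge s hb) ht0
    have h3 := hd2 p ha
    linarith

end Quasisymmetry

/-! ### Approximation of a quasisymmetric metric on a Riemannian manifold -/

section Approximation

variable {n : ℕ} {X : Type u} [TopologicalSpace X] [T2Space X] [CompactSpace X] [ConnectedSpace X]
  [ChartedSpace (EuclideanSpace ℝ (Fin n)) X] [IsManifold (𝓡 n) ∞ X]
  {g : SmoothRiemannianMetric n X} {d : MetricSpace X} {ε : ℝ} {η : ℝ≥0 ≃ₜ ℝ≥0} {δ : X → ℝ}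

theorem exists_contMDiff_between (hε : 0 < ε) (hδ : ∀ x, 0 < δ x)
    (hlip : ∀ x y, δ x ≤ δ y + g.metricSpace.dist x y) :
    ∃ φ : X → ℝ, ContMDiff (𝓡 n) 𝓘(ℝ, ℝ) ∞ φ ∧
      ∀ x, 3 * (ε / δ x) ≤ φ x ∧ φ x ≤ 6 * (ε / δ x) := by
  have hcont : Continuous δ := by
    let := g.metricSpace
    exact (LipschitzWith.of_le_add hlip).continuous
  have hcont' : Continuous fun x => ε / δ x := continuous_const.div hcont fun x => (hδ x).ne'
  obtain ⟨φ, hφ⟩ := exists_contMDiffMap_forall_mem_convex_of_local_const (n := (⊤ : ℕ∞)) (𝓡 n)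
    (t := fun x : X => Icc (3 * (ε / δ x)) (6 * (ε / δ x))) (fun x => convex_Icc _ _) (by
      intro x
      have hx : 0 < ε / δ x := div_pos hε (hδ x)
      refine ⟨4 * (ε / δ x), ?_⟩
      have h1 : ∀ᶠ y in 𝓝 x, 3 * (ε / δ y) < 4 * (ε / δ x) :=
        (hcont'.const_mul 3).continuousAt.eventually_lt continuousAt_const (by linarith)
      have h2 : ∀ᶠ y in 𝓝 x, 4 * (ε / δ x) < 6 * (ε / δ y) :=
        continuousAt_const.eventually_lt (hcont'.const_mul 6).continuousAt (by linarith)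
      filter_upwards [h1, h2] with y hy1 hy2 using ⟨hy1.le, hy2.le⟩)
  exact ⟨φ, φ.contMDiff, hφ⟩

/-- Up to the additive error `ε`, the metric `d` is dominated by the distance of a Riemannian metric
for which leaving the `g`-ball of radius `δ x / 2` around any point `x` costs at least `ε`. -/
theorem dist_le_dist_add_of_exit {h : SmoothRiemannianMetric n X} (hε : 0 < ε) (hδ : ∀ x, 0 < δ x)
    (hdsmall : ∀ x y, g.metricSpace.dist x y < δ x → d.dist x y < ε)
    (hexit : ∀ x y L, δ x / 2 ≤ g.metricSpace.dist x y → h.metricSpace.dist x y < L →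
      ∃ z, g.metricSpace.dist x z = δ x / 2 ∧ ε + h.metricSpace.dist z y < L) (x y : X) :
    d.dist x y ≤ h.metricSpace.dist x y + ε := by
  have hnn (a b) : 0 ≤ h.metricSpace.dist a b := @dist_nonneg X h.metricSpace.toPseudoMetricSpace a b
  have key (k : ℕ) : ∀ x y, h.metricSpace.dist x y < k * ε → d.dist x y ≤ k * ε := by
    induction k with
    | zero =>
      intro x y hxy
      rw [Nat.cast_zero, zero_mul] at hxy
      exact absurd hxy (hnn x y).not_gt
    | succ k ih =>
      intro x y hxy
      push_cast at hxy ⊢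
      rcases lt_or_ge (g.metricSpace.dist x y) (δ x / 2) with hlt | hge
      · have h1 := hdsmall x y (by linarith [hδ x])
        have h2 : 0 ≤ k * ε := by positivity
        linarith
      · obtain ⟨z, hz, hzy⟩ := hexit x y _ hge hxy
        have h1 := hdsmall x z (by linarith [hδ x])
        have h2 := ih z y (by linarith)
        have h3 := d.dist_triangle x z y
        linarith
  have h1 : h.metricSpace.dist x y < ((⌊h.metricSpace.dist x y / ε⌋₊ + 1 : ℕ) : ℝ) * ε := by
    rw [← div_lt_iff₀ hε]
    exact_mod_cast Nat.lt_floor_add_one _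
  refine (key _ x y h1).trans ?_
  push_cast
  have h2 := Nat.floor_le (div_nonneg (hnn x y) hε.le)
  rw [le_div_iff₀ hε] at h2
  linarith

/-- The approximation at level `ε`: `g` is rescaled so that balls of the natural radius get size
`ε`, and the resulting distance is spliced with `d`. -/
theorem exists_approximation (hd : IsQuasisymmetric η d g.metricSpace) (hε : 0 < ε)
    (hne : ∃ y z, ε ≤ d.dist y z) :
    ∃ (ρ : MetricSpace X) (h : SmoothRiemannianMetric n X),
      IsLocallyIsometric ρ h.metricSpace ∧ IsQuasisymmetric (distortion η) ρ g.metricSpace ∧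
        gromovHausdorffEDist ρ d ≤ ENNReal.ofReal ε := by
  set m := g.metricSpace
  set δ := naturalScale m d ε
  have hδ : ∀ x, 0 < δ x := naturalScale_pos hε hd hne
  have hlip : ∀ x y, δ x ≤ δ y + m.dist x y := naturalScale_le_add hne
  have hdsmall : ∀ x y, m.dist x y < δ x → d.dist x y < ε := fun _ _ => dist_lt_of_lt_naturalScale
  obtain ⟨φ, hφ, hφδ⟩ := exists_contMDiff_between (g := g) hε hδ hlip
  have hk (x : X) : 0 < ε / δ x := div_pos hε (hδ x)
  have hkδ (x : X) : ε / δ x * δ x = ε := div_mul_cancel₀ _ (hδ x).ne'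
  have hφpos (x : X) : 0 < φ x := (mul_pos three_pos (hk x)).trans_le (hφδ x).1
  set h := g.conformal φ hφ hφpos with hh
  -- on the ball of radius `δ x / 2` around `x`, the scale is between `δ x / 2` and `3 δ x / 2`
  have hφge (x z : X) (hz : m.dist x z ≤ δ x / 2) : 2 * (ε / δ x) ≤ φ z := by
    refine le_trans ?_ (hφδ z).1
    have h1 := hlip z x
    rw [m.dist_comm z x] at h1
    rw [← mul_div_assoc, ← mul_div_assoc, div_le_div_iff₀ (hδ x) (hδ z)]
    nlinarith
  have hφle (x z : X) (hz : m.dist x z < δ x / 2) : φ z ≤ 12 * (ε / δ x) := by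
    refine (hφδ z).2.trans ?_
    have h1 := hlip x z
    rw [← mul_div_assoc, ← mul_div_assoc, div_le_div_iff₀ (hδ z) (hδ x)]
    nlinarith
  have hupper (x y : X) (hxy : m.dist x y < δ x / 2) :
      h.metricSpace.dist x y ≤ 12 * (ε / δ x) * m.dist x y := by
    refine SmoothRiemannianMetric.dist_le_mul_dist (mul_pos (by norm_num) (hk x)).le hxy
      fun z hz v => ?_
    rw [hh, SmoothRiemannianMetric.conformal_inner]
    exact mul_le_mul_of_nonneg_right (pow_le_pow_left₀ (hφpos z).le (hφle x z hz) 2)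
      (g.inner_self_nonneg z v)
  have hcross (x y : X) (r L : ℝ) (hr : 0 ≤ r) (hrδ : r ≤ δ x / 2) (hxy : r ≤ m.dist x y)
      (hL : h.metricSpace.dist x y < L) :
      ∃ z, m.dist x z = r ∧ 2 * (ε / δ x) * r + h.metricSpace.dist z y < L := by
    have hk0 := (mul_pos two_pos (hk x)).le
    refine SmoothRiemannianMetric.exists_dist_eq_and_add_dist_lt hk0 hr hxy (fun z hz v => ?_) hL
    rw [hh, SmoothRiemannianMetric.conformal_inner]
    exact mul_le_mul_of_nonneg_right (pow_le_pow_left₀ hk0 (hφge x z (hz.trans hrδ)) 2)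
      (g.inner_self_nonneg z v)
  have hlower (x y : X) (r : ℝ) (hr : 0 ≤ r) (hrδ : r ≤ δ x / 2) (hxy : r ≤ m.dist x y) :
      2 * (ε / δ x) * r ≤ h.metricSpace.dist x y := by
    refine le_of_forall_gt fun L hL => ?_
    obtain ⟨z, -, hz⟩ := hcross x y r L hr hrδ hxy hL
    linarith [@dist_nonneg X h.metricSpace.toPseudoMetricSpace z y]
  have hhalf (x : X) : 2 * (ε / δ x) * (δ x / 2) = ε := by linarith [hkδ x]
  have hde : ∀ x y, d.dist x y ≤ h.metricSpace.dist x y + ε := by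
    refine dist_le_dist_add_of_exit hε hδ hdsmall fun x y L hxy hL => ?_
    obtain ⟨z, hz1, hz2⟩ := hcross x y _ L (half_pos (hδ x)).le le_rfl hxy hL
    exact ⟨z, hz1, by rwa [hhalf] at hz2⟩
  have hnn (x y) : 0 ≤ m.dist x y := @dist_nonneg X m.toPseudoMetricSpace x y
  have hmin := min_le_spliceMetric_dist (e := h.metricSpace) hε hde
  refine ⟨spliceMetric h.metricSpace d ε hε hde, h, isLocallyIsometric_spliceMetric hε hde, ?_, ?_⟩
  · refine isQuasisymmetric_distortion hε hδ hd hdsmall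
      (fun x => exists_dist_le_two_mul_naturalScale hne (hδ x)) (fun x y hxy => ?_)
      (fun x y hxy => (spliceMetric_dist_le_left hε hde x y).trans (hupper x y hxy))
      (fun x y hxy => ?_) (fun x y hxy => ?_) (spliceMetric_dist_le_add hε hde)
      (dist_le_spliceMetric_dist_add hε hde)
    · have hsub := intermediate_value_univ x y (g.continuous_dist x)
      exact hsub ⟨(m.dist_self x).trans_le (half_pos (hδ x)).le, hxy⟩
    · refine (le_min (hlower x y _ (hnn x y) hxy le_rfl) ?_).trans (hmin x y)
      have h1 := mul_le_mul_of_nonneg_left hxy (mul_pos two_pos (hk x)).le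
      rw [hhalf] at h1
      linarith
    · refine (le_min ?_ (by linarith)).trans (hmin x y)
      exact (hhalf x).symm.trans_le (hlower x y _ (half_pos (hδ x)).le le_rfl hxy)
  · refine gromovHausdorffEDist_le _ _ hε fun x y => abs_le.2 ⟨?_, ?_⟩
    · linarith [dist_le_spliceMetric_dist_add (e := h.metricSpace) hε hde x y]
    · linarith [spliceMetric_dist_le_add (e := h.metricSpace) hε hde x y]

end Approximation

theorem theorem1p1 (n : ℕ) (η : ℝ≥0 ≃ₜ ℝ≥0) :
    ∃ η' : ℝ≥0 ≃ₜ ℝ≥0,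
      ∀ (X : Type u) [TopologicalSpace X] [T2Space X] [CompactSpace X] [ConnectedSpace X]
        [ChartedSpace (EuclideanSpace ℝ (Fin n)) X] [IsManifold (𝓡 n) ∞ X]
        (g : SmoothRiemannianMetric n X) (d : MetricSpace X),
        IsQuasisymmetric η d (SmoothRiemannianMetric.metricSpace g) →
        ∃ (ρ : ℕ → MetricSpace X) (h : ℕ → SmoothRiemannianMetric n X),
          (∀ k, IsLocallyIsometric (ρ k) (SmoothRiemannianMetric.metricSpace (h k))) ∧
          (∀ k, IsQuasisymmetric η' (ρ k) (SmoothRiemannianMetric.metricSpace g)) ∧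
          Tendsto (fun k => gromovHausdorffEDist (ρ k) d) atTop (𝓝 0) := by
  refine ⟨distortion η, fun X _ _ _ _ _ _ g d hd => ?_⟩
  rcases subsingleton_or_nontrivial X with hX | hX
  · -- for a one-point space, `d` itself is the distance of `g`
    refine ⟨fun _ => d, fun _ => g, fun _ x => ⟨univ, mem_univ x, ?_, ?_, fun p _ q _ => ?_⟩,
      fun _ p q s hs => absurd (Subsingleton.elim s q) hs, ?_⟩
    · exact @isOpen_univ X d.toUniformSpace.toTopologicalSpace
    · exact @isOpen_univ X g.metricSpace.toUniformSpace.toTopologicalSpace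
    · rw [Subsingleton.elim p q, d.dist_self, g.metricSpace.dist_self]
    · have h0 : gromovHausdorffEDist d d = 0 := by
        refine le_antisymm (iInf_le_of_le X (iInf_le_of_le d (iInf_le_of_le id
          (iInf_le_of_le id (iInf_le_of_le isometry_id (iInf_le_of_le isometry_id ?_)))))) zero_le
        rw [Metric.hausdorffEDist_self]
      simp only [h0, tendsto_const_nhds]
  · obtain ⟨y, z, hyz⟩ := exists_pair_ne X
    have hpos : 0 < d.dist y z := (@dist_pos X d _ _).2 hyz
    have hε (k : ℕ) : 0 < d.dist y z / (k + 1) := by positivity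
    have hle (k : ℕ) : d.dist y z / (k + 1) ≤ d.dist y z :=
      div_le_self hpos.le (by linarith [(Nat.cast_nonneg k : (0 : ℝ) ≤ k)])
    choose ρ h hiso hqs hGH using fun k => exists_approximation hd (hε k) ⟨y, z, hle k⟩
    refine ⟨ρ, h, hiso, hqs, ?_⟩
    refine tendsto_of_tendsto_of_tendsto_of_le_of_le tendsto_const_nhds ?_ (fun _ => zero_le) hGH
    have hlim : Tendsto (fun k : ℕ => d.dist y z / ((k : ℝ) + 1)) atTop (𝓝 0) :=
      tendsto_const_nhds.div_atTop
        (tendsto_atTop_add_const_right _ _ tendsto_natCast_atTop_atTop)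
    simpa using ENNReal.tendsto_ofReal hlim
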